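/- Let $\mathcal M$ be an $n$-dimensional smooth Riemannian manifold (without boundary), let $\mathbb Y$ be a Euclidean space (a finite-dimensional real inner product space), let $f:\mathcal M\to\mathbb R$ and $g:\mathcal M\to\mathbb Y$ be twice continuously differentiable, and let $\mathcal K\subset\mathbb Y$ be a nonempty closed convex set. Consider the problem $$\min f(x)\quad\text{s.t.}\quad g(x)\in\mathcal K,\; x\in\mathcal M .$$ For $y\in\mathcal K$, the tangent cone to $\mathcal K$ at $y$ is $$\mathcal T_{\mathcal K}(y)=\{d\in\mathbb Y\mid \exists\, t^k\downarrow 0,\ \operatorname{dist}(y+t^kd,\mathcal K)=o(t^k)\},$$ and the normal cone is its polar, $\mathcal N_{\mathcal K}(y)=\{v\in\mathbb Y\mid \langle v,d\rangle\le 0\ \ \forall d\in\mathcal T_{\mathcal K}(y)\}$. Put $L(x;y)=f(x)+\langle y,g(x)\rangle$, and let $$M(x)=\{y\in\mathbb Y\mid \operatorname{grad}_xL(x;y)=0,\ y\in\mathcal N_{\mathcal K}(g(x))\}$$ be the set of Lagrange multipliers at $x$, where $\operatorname{grad}$ is the Riemannian gradient. The manifold Robinson constraint qualification (M-RCQ)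 holds at a feasible point $x$ if $$Dg(x)\,T_x\mathcal M+\mathcal T_{\mathcal K}(g(x))=\mathbb Y .$$ Theorem. Suppose that $x^*$ is a locally optimal solution of the problem. Then $M(x^*)$ is a nonempty, convex, bounded and compact subset of $\mathbb Y$ if and only if the M-RCQ holds at $x^*$. -/

import Mathlib

open Set Filter Topology Asymptotics Bundle Manifold
open scoped ContDiff Pointwise RealInnerProductSpace

noncomputable section

section ConvexAnalysis

variable {Y : Type*} [NormedAddCommGroup Y] [InnerProductSpace ℝ Y]

/-- The (Bouligand) tangent cone to `D` at `y`: the directions `d` for which there are `t k ↓ 0`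
with `dist (y + t k • d, D) = o(t k)`. -/
def bouligandTangentCone (D : Set Y) (y : Y) : Set Y :=
  {d | ∃ t : ℕ → ℝ, (∀ k, 0 < t k) ∧ Tendsto t atTop (𝓝 0) ∧
    (fun k => Metric.infDist (y + t k • d) D) =o[atTop] t}

/-- The normal cone to `D` at `y`: the polar of the tangent cone. -/
def polarNormalCone (D : Set Y) (y : Y) : Set Y :=
  {v | ∀ d ∈ bouligandTangentCone D y, ⟪v, d⟫ ≤ 0}

end ConvexAnalysis

section Manifold

variable {n : ℕ} {M : Type*} [TopologicalSpace M] [ChartedSpace (EuclideanSpace ℝ (Fin n)) M]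
  {Y : Type*} [NormedAddCommGroup Y] [InnerProductSpace ℝ Y]

/-- `x` is a locally optimal solution of `min f(x)` subject to `g(x) ∈ K`, `x ∈ M`. -/
def IsLocallyOptimal (f : M → ℝ) (g : M → Y) (K : Set Y) (x : M) : Prop :=
  g x ∈ K ∧ IsLocalMinOn f {z | g z ∈ K} x

/-- The Lagrangian `L(x; y) = f(x) + ⟨y, g(x)⟩`. -/
def lagrangian (f : M → ℝ) (g : M → Y) (y : Y) (x : M) : ℝ :=
  f x + ⟪y, g x⟫

/-- The manifold Robinson constraint qualification at a feasible point `x`: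
`Dg(x) T_x M + T_K(g(x)) = Y`. -/
def MRCQ (g : M → Y) (K : Set Y) (x : M) : Prop :=
  g x ∈ K ∧ Set.range (mvfderiv (𝓡 n) g x) + bouligandTangentCone K (g x) = Set.univ

variable [RiemannianBundle (fun x : M => TangentSpace (𝓡 n) x)]

/-- The Riemannian gradient of `h` at `x`: the tangent vector that represents the differential
of `h` with respect to the Riemannian inner product on `T_x M`. -/
def riemannianGrad (h : M → ℝ) (x : M) : TangentSpace (𝓡 n) x :=
  haveI : FiniteDimensional ℝ (TangentSpace (𝓡 n) x) :=
    inferInstanceAs (FiniteDimensional ℝ (EuclideanSpace ℝ (Fin n)))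
  haveI : CompleteSpace (TangentSpace (𝓡 n) x) := FiniteDimensional.complete ℝ _
  (InnerProductSpace.toDual ℝ (TangentSpace (𝓡 n) x)).symm (mvfderiv (𝓡 n) h x)

theorem inner_riemannianGrad (h : M → ℝ) (x : M) (ξ : TangentSpace (𝓡 n) x) :
    inner ℝ (riemannianGrad h x) ξ = mvfderiv (𝓡 n) h x ξ := by
  simp [riemannianGrad]

/-- The set of Lagrange multipliers at `x`: all `y` satisfying the KKT conditions
`grad_x L(x; y) = 0` and `y ∈ N_K(g(x))`. -/
def multiplierSet (f : M → ℝ) (g : M → Y) (K : Set Y) (x : M) : Set Y :=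
  {y | riemannianGrad (n := n) (lagrangian f g y) x = 0 ∧ y ∈ polarNormalCone K (g x)}

end Manifold

end

/-! With A = Dg(x) and c = Df(x), multipliers are the v in the normal cone with c + ⟨v, A·⟩ = 0: a
closed convex set. A singular multiplier is a normal v with ⟨v, A·⟩ = 0; the set of multipliers is
stable under adding these.

Robinson's condition is equivalent to having no nonzero singular multiplier. If it fails, range A +
cone (K - g(x)) is a proper convex cone, and a half-space containing it yields a singular v ≠ 0
(`exists_singular_multiplier`); a nonempty multiplier set then contains a ray, so it is unbounded.
If it holds, every d is A h + τ with τ tangent, so ⟨v, d⟩ ≤ -c h for all multipliers v, and uniform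
boundedness bounds their set.

Nonemptiness is the only place where optimality beyond feasibility enters. In a chart, a quadratic
penalty argument gives Fritz John multipliers (μ, y) ≠ 0 (`fritz_john`). If μ = 0, then y would be a
nonzero singular multiplier; otherwise y / μ is a Lagrange multiplier. -/

section NormalCone

/-! ### Normal cones of convex sets and abstract multiplier sets -/

variable {Y : Type*} [NormedAddCommGroup Y] [InnerProductSpace ℝ Y]

/-- Feasible directions of a convex set belong to its tangent cone. -/
theorem smul_sub_mem_bouligandTangentCone {K : Set Y} (hK : Convex ℝ K) {y z : Y} (hy : y ∈ K)
    (hz : z ∈ K) {s : ℝ} (hs : 0 < s) : s • (z - y) ∈ bouligandTangentCone K y := by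
  -- The factor s⁻¹ cancels s, so the test points y + (z - y)/(k + 1) stay on the segment from y to
  -- z, at distance 0 from K.
  refine ⟨fun k => s⁻¹ * (1 / ((k : ℝ) + 1)), fun k => by positivity, ?_, ?_⟩
  · simpa using tendsto_one_div_add_atTop_nhds_zero_nat.const_mul s⁻¹
  · have h0 : (fun k : ℕ => Metric.infDist (y + (s⁻¹ * (1 / ((k : ℝ) + 1))) • s • (z - y)) K)
        = fun _ => 0 := by
      funext k
      refine Metric.infDist_zero_of_mem ?_
      have : (s⁻¹ * (1 / ((k : ℝ) + 1))) • s • (z - y) = (1 / ((k : ℝ) + 1)) • (z - y) := by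
        rw [smul_smul]
        congr 1
        field_simp
      rw [this]
      refine hK.add_smul_sub_mem hy hz ⟨by positivity, ?_⟩
      rw [div_le_one (by positivity)]
      linarith [(Nat.cast_nonneg k : (0 : ℝ) ≤ k)]
    rw [h0]
    exact isLittleO_zero _ _

/-- For a convex set, the polar of the tangent cone is the normal cone of convex analysis. -/
theorem mem_polarNormalCone_iff {K : Set Y} (hK : Convex ℝ K) {y : Y} (hy : y ∈ K) {v : Y} :
    v ∈ polarNormalCone K y ↔ ∀ z ∈ K, ⟪v, z - y⟫ ≤ 0 := by
  constructor
  · intro hv z hz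
    simpa using hv _ (smul_sub_mem_bouligandTangentCone hK hy hz one_pos)
  · rintro hv d ⟨t, ht, -, hto⟩
    have hbound : ∀ k, ⟪v, d⟫ ≤ ‖v‖ * (Metric.infDist (y + t k • d) K / t k) := by
      intro k
      have h1 : t k * ⟪v, d⟫ ≤ ‖v‖ * Metric.infDist (y + t k • d) K := by
        -- K need not be closed here, so an almost nearest z replaces the projection; the + 1 in ε /
        -- (‖v‖ + 1) covers v = 0.
        refine le_of_forall_pos_le_add fun ε hε => ?_
        obtain ⟨z, hz, hdist⟩ := (Metric.infDist_lt_iff ⟨y, hy⟩).1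
          (lt_add_of_pos_right (Metric.infDist (y + t k • d) K)
            (show 0 < ε / (‖v‖ + 1) by positivity))
        have hsplit : t k * ⟪v, d⟫ = ⟪v, y + t k • d - z⟫ + ⟪v, z - y⟫ := by
          rw [← inner_add_right, ← real_inner_smul_right]
          congr 1
          abel
        calc t k * ⟪v, d⟫ ≤ ⟪v, y + t k • d - z⟫ := by linarith [hv z hz]
          _ ≤ ‖v‖ * dist (y + t k • d) z := by
            rw [dist_eq_norm]
            exact real_inner_le_norm _ _
          _ ≤ ‖v‖ * (Metric.infDist (y + t k • d) K + ε / (‖v‖ + 1)) := by gcongr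
          _ = ‖v‖ * Metric.infDist (y + t k • d) K + ‖v‖ / (‖v‖ + 1) * ε := by ring
          _ ≤ ‖v‖ * Metric.infDist (y + t k • d) K + 1 * ε := by
            gcongr
            rw [div_le_one (by positivity)]
            linarith
          _ = _ := by rw [one_mul]
      rw [← mul_div_assoc, le_div_iff₀ (ht k)]
      linarith
    have hlim : Tendsto (fun k => ‖v‖ * (Metric.infDist (y + t k • d) K / t k)) atTop (𝓝 0) := by
      simpa using hto.tendsto_div_nhds_zero.const_mul ‖v‖
    exact ge_of_tendsto' hlim hbound

variable {E : Type*} [AddCommGroup E] [Module ℝ E]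

/-- An intersection of closed hyperplanes and half-spaces. The linear maps `A` and `c` stand for the
differentials of g and f, and `E` needs no topology. -/
theorem isClosed_multipliers {K : Set Y} {y : Y} (A : E →ₗ[ℝ] Y) (c : E →ₗ[ℝ] ℝ) :
    IsClosed {v : Y | (∀ h, c h + ⟪v, A h⟫ = 0) ∧ v ∈ polarNormalCone K y} := by
  simp only [polarNormalCone, ofPred_and, ofPred_forall]
  refine (isClosed_iInter fun h => isClosed_eq (by fun_prop) continuous_const).inter
    (isClosed_iInter fun d => isClosed_iInter fun _ => isClosed_le (by fun_prop) continuous_const)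

theorem convex_multipliers {K : Set Y} {y : Y} (A : E →ₗ[ℝ] Y) (c : E →ₗ[ℝ] ℝ) :
    Convex ℝ {v : Y | (∀ h, c h + ⟪v, A h⟫ = 0) ∧ v ∈ polarNormalCone K y} := by
  rintro v ⟨hv, hv'⟩ w ⟨hw, hw'⟩ a b ha hb hab
  refine ⟨fun h => ?_, fun d hd => ?_⟩
  · rw [inner_add_left, real_inner_smul_left, real_inner_smul_left]
    linear_combination a * hv h + b * hw h - c h * hab
  · rw [inner_add_left, real_inner_smul_left, real_inner_smul_left]
    nlinarith [mul_nonneg ha (neg_nonneg.2 (hv' d hd)), mul_nonneg hb (neg_nonneg.2 (hw' d hd))]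

/-- Under Robinson's constraint qualification there is no nonzero singular multiplier. -/
theorem eq_zero_of_singular_multiplier {K : Set Y} {y : Y} (A : E →ₗ[ℝ] Y)
    (hA : range A + bouligandTangentCone K y = univ) {v : Y} (hvA : ∀ h, ⟪v, A h⟫ = 0)
    (hv : v ∈ polarNormalCone K y) : v = 0 := by
  obtain ⟨-, ⟨h, rfl⟩, d, hd, hvd⟩ : v ∈ range A + bouligandTangentCone K y := by
    rw [hA]
    trivial
  have h1 : ⟪v, v⟫ ≤ 0 := by
    nth_rewrite 2 [← hvd]
    rw [inner_add_right, hvA, zero_add]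
    exact hv d hd
  exact inner_self_eq_zero.1 (le_antisymm h1 real_inner_self_nonneg)

end NormalCone

/-! ### Separation of cones, and boundedness of the multiplier set -/

section Separation

variable {Y : Type*} [NormedAddCommGroup Y] [InnerProductSpace ℝ Y] [FiniteDimensional ℝ Y]

/-- A proper convex cone (not necessarily closed) of a finite-dimensional space that contains the
origin lies in a closed half-space. -/
theorem ConvexCone.exists_ne_zero_inner_nonpos (C : ConvexCone ℝ Y) (h0 : (0 : Y) ∈ C)
    (hC : (C : Set Y) ≠ univ) : ∃ v : Y, v ≠ 0 ∧ ∀ c ∈ C, ⟪v, c⟫ ≤ 0 := by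
  -- With interior points, Hahn–Banach separates the cone from a missed point; without them, the
  -- cone spans a proper subspace and any orthogonal vector works.
  by_cases hint : (interior (C : Set Y)).Nonempty
  · obtain ⟨p, hp⟩ := (ne_univ_iff_exists_notMem _).1 hC
    obtain ⟨φ, hφ, hle⟩ := geometric_hahn_banach_of_nonempty_interior_point C.convex
      (fun h => hp (interior_subset h)) hint
    refine ⟨(InnerProductSpace.toDual ℝ Y).symm φ, by simpa using hφ, fun c hc => ?_⟩
    rw [InnerProductSpace.toDual_symm_apply]
    by_contra! hpos
    -- Rescaling c within the cone gives φ the value |φ p| + 1, above the bound φ p.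
    have h1 := hle (((|φ p| + 1) / φ c) • c) (C.smul_mem (by positivity) hc)
    rw [map_smul, smul_eq_mul, div_mul_cancel₀ _ hpos.ne'] at h1
    linarith [le_abs_self (φ p)]
  · rw [C.convex.interior_nonempty_iff_affineSpan_eq_top,
      AffineSubspace.affineSpan_eq_top_iff_vectorSpan_eq_top_of_nonempty ℝ Y Y ⟨0, h0⟩,
      vectorSpan_eq_span_vsub_set_right ℝ (show (0 : Y) ∈ (C : Set Y) from h0)] at hint
    have hspan : Submodule.span ℝ (C : Set Y) ≠ ⊤ := by simpa using hint
    have horth : (Submodule.span ℝ (C : Set Y))ᗮ ≠ ⊥ := fun h =>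
      hspan ((Submodule.orthogonal_eq_bot_iff).1 h)
    obtain ⟨v, hv, hv0⟩ := Submodule.exists_mem_ne_zero_of_ne_bot horth
    exact ⟨v, hv0, fun c hc =>
      (Submodule.inner_left_of_mem_orthogonal (Submodule.subset_span hc) hv).le⟩

variable {E : Type*} [AddCommGroup E] [Module ℝ E]

/-- If Robinson's constraint qualification fails, there is a nonzero singular multiplier. -/
theorem exists_singular_multiplier {K : Set Y} (hK : Convex ℝ K) {y : Y} (hy : y ∈ K)
    (A : E →ₗ[ℝ] Y) (hA : range A + bouligandTangentCone K y ≠ univ) :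
    ∃ v : Y, v ≠ 0 ∧ (∀ h, ⟪v, A h⟫ = 0) ∧ v ∈ polarNormalCone K y := by
  -- K - y generates only feasible directions, which all lie in the tangent cone; hence the cone
  -- over S misses a point whenever Robinson's condition fails.
  let S : Set Y := range A + (fun z => z - y) '' K
  have hS : Convex ℝ S := by
    refine Convex.add ?_ ?_
    · rw [← LinearMap.coe_range]
      exact (LinearMap.range A).convex
    · simpa [sub_eq_add_neg] using hK.translate (-y) |> fun h => by
        simpa [add_comm] using h
  have hmem : ∀ h, ∀ z ∈ K, A h + (z - y) ∈ S := fun h z hz =>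
    add_mem_add (mem_range_self h) (mem_image_of_mem _ hz)
  obtain ⟨v, hv0, hv⟩ := (ConvexCone.hull ℝ S).exists_ne_zero_inner_nonpos
    (ConvexCone.subset_hull (by simpa using hmem 0 y hy)) (by
      refine fun huniv => hA (eq_univ_of_forall fun p => ?_)
      have hp : p ∈ ConvexCone.hull ℝ S := by
        rw [← SetLike.mem_coe, huniv]
        trivial
      obtain ⟨r, hr, -, ⟨-, ⟨h, rfl⟩, -, ⟨z, hz, rfl⟩, rfl⟩, rfl⟩ :=
        (ConvexCone.mem_hull_of_convex hS).1 hp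
      simp only [smul_add]
      exact add_mem_add ⟨r • h, map_smul A r h⟩
        (smul_sub_mem_bouligandTangentCone hK hy hz hr))
  have hle : ∀ h, ⟪v, A h⟫ ≤ 0 := fun h => by
    simpa using hv _ (ConvexCone.subset_hull (hmem h y hy))
  refine ⟨v, hv0, fun h => le_antisymm (hle h) ?_, (mem_polarNormalCone_iff hK hy).2 fun z hz => ?_⟩
  · simpa using hle (-h)
  · simpa using hv _ (ConvexCone.subset_hull (hmem 0 z hz))

/-- Under Robinson's constraint qualification the set of multipliers is bounded. -/
theorem isBounded_multipliers {K : Set Y} {y : Y} (A : E →ₗ[ℝ] Y) (c : E →ₗ[ℝ] ℝ)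
    (hA : range A + bouligandTangentCone K y = univ) :
    Bornology.IsBounded {v : Y | (∀ h, c h + ⟪v, A h⟫ = 0) ∧ v ∈ polarNormalCone K y} := by
  set S := {v : Y | (∀ h, c h + ⟪v, A h⟫ = 0) ∧ v ∈ polarNormalCone K y} with hS
  have hub : ∀ d : Y, ∃ B : ℝ, ∀ v ∈ S, ⟪v, d⟫ ≤ B := by
    intro d
    obtain ⟨-, ⟨h, rfl⟩, τ, hτ, rfl⟩ : d ∈ range A + bouligandTangentCone K y := by
      rw [hA]
      trivial
    refine ⟨-c h, fun v hv => ?_⟩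
    rw [inner_add_right]
    linarith [hv.1 h, hv.2 τ hτ]
  have hpt : ∀ d : Y, ∃ B, ∀ v : S, ‖innerSL ℝ (v : Y) d‖ ≤ B := by
    intro d
    obtain ⟨B, hB⟩ := hub d
    obtain ⟨B', hB'⟩ := hub (-d)
    refine ⟨max B B', fun v => ?_⟩
    rw [innerSL_apply_apply, Real.norm_eq_abs]
    refine abs_le'.2 ⟨(hB v v.2).trans (le_max_left _ _), ?_⟩
    rw [← inner_neg_right]
    exact (hB' v v.2).trans (le_max_right _ _)
  have : CompleteSpace Y := FiniteDimensional.complete ℝ Y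
  obtain ⟨B, hB⟩ := banach_steinhaus hpt
  refine isBounded_iff_forall_norm_le.2 ⟨B, fun v hv => ?_⟩
  simpa using hB ⟨v, hv⟩

/-- If the set of multipliers is nonempty and bounded, Robinson's constraint qualification holds. -/
theorem robinson_of_isBounded_multipliers {K : Set Y} (hK : Convex ℝ K) {y : Y} (hy : y ∈ K)
    (A : E →ₗ[ℝ] Y) (c : E →ₗ[ℝ] ℝ)
    (hne : {v : Y | (∀ h, c h + ⟪v, A h⟫ = 0) ∧ v ∈ polarNormalCone K y}.Nonempty)
    (hbdd : Bornology.IsBounded {v : Y | (∀ h, c h + ⟪v, A h⟫ = 0) ∧ v ∈ polarNormalCone K y}) :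
    range A + bouligandTangentCone K y = univ := by
  by_contra hA
  obtain ⟨v, hv0, hvA, hvN⟩ := exists_singular_multiplier hK hy A hA
  obtain ⟨w, hw, hwN⟩ := hne
  obtain ⟨B, hB⟩ := isBounded_iff_forall_norm_le.1 hbdd
  have hvpos : 0 < ‖v‖ := norm_pos_iff.2 hv0
  have hBw : ‖w‖ ≤ B := hB w ⟨hw, hwN⟩
  have hB0 : 0 ≤ B := (norm_nonneg w).trans hBw
  -- Chosen so that ‖s • v‖ = 2B + 1, whereas w and w + s • v both have norm at most B.
  set s : ℝ := (2 * B + 1) / ‖v‖ with hs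
  have hs0 : 0 ≤ s := by positivity
  have hmem := hB (w + s • v) ⟨fun h => by
    rw [inner_add_left, real_inner_smul_left, hvA, mul_zero, add_zero]
    exact hw h, fun d hd => by
    rw [inner_add_left, real_inner_smul_left]
    nlinarith [hwN d hd, mul_nonneg hs0 (neg_nonneg.2 (hvN d hd))]⟩
  have hnorm : ‖s • v‖ = 2 * B + 1 := by
    rw [norm_smul, Real.norm_of_nonneg hs0, hs, div_mul_cancel₀ _ hvpos.ne']
  have htri : ‖s • v‖ ≤ ‖w + s • v‖ + ‖w‖ := by
    simpa using norm_sub_le (w + s • v) w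
  linarith

end Separation

/-! ### Fritz John conditions by quadratic penalization -/

section FritzJohn

variable {Y : Type*} [NormedAddCommGroup Y] [InnerProductSpace ℝ Y]
  {E : Type*} [NormedAddCommGroup E] [InnerProductSpace ℝ E]

/-- Stationarity of a local minimizer of the penalty function. -/
theorem stationarity_of_isLocalMin_penalty {F : E → ℝ} {G : E → Y} {K : Set Y} {a x : E} {k : ℝ}
    (hk : 0 ≤ k) (hF : DifferentiableAt ℝ F x) (hG : DifferentiableAt ℝ G x)
    (hmin : IsLocalMin (fun z => F z + ‖z - a‖ ^ 2 + k * Metric.infDist (G z) K ^ 2) x)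
    {p : Y} (hp : p ∈ K) (hdist : Metric.infDist (G x) K = ‖G x - p‖) (h : E) :
    fderiv ℝ F x h + 2 * ⟪x - a, h⟫ + ⟪(2 * k) • (G x - p), fderiv ℝ G x h⟫ = 0 := by
  -- Replacing the distance to K by the distance to the fixed point p majorizes the penalty, with
  -- equality at x; the minimum persists and the function is now differentiable at x.
  have hmin' : IsLocalMin (fun z => F z + ‖z - a‖ ^ 2 + k * ‖G z - p‖ ^ 2) x := by
    filter_upwards [hmin] with z hz
    simp only [hdist] at hz
    have hle : Metric.infDist (G z) K ≤ ‖G z - p‖ := by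
      rw [← dist_eq_norm]
      exact Metric.infDist_le_dist_of_mem hp
    have : k * Metric.infDist (G z) K ^ 2 ≤ k * ‖G z - p‖ ^ 2 := by
      gcongr
      exact Metric.infDist_nonneg
    linarith
  have hder := (hF.hasFDerivAt.add ((hasFDerivAt_id x).sub_const a).norm_sq).add
    ((hG.hasFDerivAt.sub_const p).norm_sq.const_mul k)
  have hzero := DFunLike.congr_fun (hmin'.hasFDerivAt_eq_zero hder) h
  simp at hzero
  rw [real_inner_smul_left, inner_sub_left, inner_sub_left]
  linarith

variable [FiniteDimensional ℝ Y] [FiniteDimensional ℝ E]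

/-- Existence and variational characterization of the projection onto a closed convex set. -/
theorem exists_projection {K : Set Y} (hne : K.Nonempty) (hclosed : IsClosed K)
    (hconv : Convex ℝ K) (u : Y) :
    ∃ p ∈ K, Metric.infDist u K = ‖u - p‖ ∧ ∀ z ∈ K, ⟪u - p, z - p⟫ ≤ 0 := by
  obtain ⟨p, hp, hup⟩ := hclosed.exists_infDist_eq_dist hne u
  rw [dist_eq_norm] at hup
  refine ⟨p, hp, hup, (norm_eq_iInf_iff_real_inner_le_zero hconv hp).1 ?_⟩
  rw [← hup, Metric.infDist_eq_iInf]
  simp [dist_eq_norm]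

/-- Minimizers of the penalty functions on a ball around a constrained minimizer. -/
theorem exists_penalty_minimizers {Z : Type*} [NormedAddCommGroup Z] {F : E → ℝ} {G : E → Z}
    {K : Set Z} (hclosed : IsClosed K)
    {a : E} {r : ℝ} (hr : 0 < r) (hF : ContinuousOn F (Metric.closedBall a r))
    (hG : ContinuousOn G (Metric.closedBall a r)) (ha : G a ∈ K)
    (hmin : ∀ z ∈ Metric.closedBall a r, G z ∈ K → F a ≤ F z) :
    ∃ (x : ℕ → E) (k : ℕ → ℝ), (∀ j, 0 ≤ k j) ∧ Tendsto x atTop (𝓝 a) ∧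
      ∀ j, IsMinOn (fun z => F z + ‖z - a‖ ^ 2 + k j * Metric.infDist (G z) K ^ 2)
        (Metric.closedBall a r) (x j) := by
  have hcomp : IsCompact (Metric.closedBall a r) := isCompact_closedBall a r
  have hdc : ContinuousOn (fun z => Metric.infDist (G z) K) (Metric.closedBall a r) :=
    (Metric.continuous_infDist_pt K).comp_continuousOn hG
  have hex : ∀ j : ℕ, ∃ x ∈ Metric.closedBall a r,
      IsMinOn (fun z => F z + ‖z - a‖ ^ 2 + (j : ℝ) * Metric.infDist (G z) K ^ 2)
        (Metric.closedBall a r) x := fun j =>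
    hcomp.exists_isMinOn ⟨a, Metric.mem_closedBall_self hr.le⟩ (by fun_prop)
  choose x hxmem hxmin using hex
  have hval : ∀ j, F (x j) + ‖x j - a‖ ^ 2 + (j : ℝ) * Metric.infDist (G (x j)) K ^ 2 ≤ F a := by
    intro j
    have := hxmin j (Metric.mem_closedBall_self hr.le)
    simpa [Metric.infDist_zero_of_mem ha] using this
  obtain ⟨m, hm⟩ := (hcomp.image_of_continuousOn hF).bddBelow
  have hmF : ∀ j, m ≤ F (x j) := fun j => hm (mem_image_of_mem F (hxmem j))
  obtain ⟨xbar, hxbar, φ, hφ, hlim⟩ := hcomp.tendsto_subseq hxmem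
  have hlimW : Tendsto (x ∘ φ) atTop (𝓝[Metric.closedBall a r] xbar) :=
    tendsto_nhdsWithin_iff.2 ⟨hlim, Eventually.of_forall fun j => hxmem (φ j)⟩
  have hFlim := (hF xbar hxbar).tendsto.comp hlimW
  have hdlim := (hdc xbar hxbar).tendsto.comp hlimW
  have hd0 : Tendsto (fun j => Metric.infDist (G (x (φ j))) K ^ 2) atTop (𝓝 0) := by
    -- The value at a bounds φ j times the squared distance by F a - m, forcing the cluster point to
    -- be feasible.
    have hup : Tendsto (fun j : ℕ => (F a - m) / (φ j : ℝ)) atTop (𝓝 0) :=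
      (tendsto_const_div_atTop_nhds_zero_nat (F a - m)).comp hφ.tendsto_atTop
    refine tendsto_of_tendsto_of_tendsto_of_le_of_le' tendsto_const_nhds hup
      (Eventually.of_forall fun j => sq_nonneg _) ?_
    filter_upwards [eventually_ge_atTop 1] with j hj
    have hφj : (0 : ℝ) < φ j := by exact_mod_cast hj.trans (hφ.id_le j)
    rw [le_div_iff₀ hφj]
    nlinarith [hval (φ j), hmF (φ j), sq_nonneg ‖x (φ j) - a‖]
  have hdbar : Metric.infDist (G xbar) K = 0 := by
    have := tendsto_nhds_unique (hdlim.pow 2) hd0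
    exact pow_eq_zero_iff (two_ne_zero) |>.1 this
  have hGbar : G xbar ∈ K := (hclosed.mem_iff_infDist_zero ⟨_, ha⟩).2 hdbar
  have hle : F xbar + ‖xbar - a‖ ^ 2 ≤ F a := by
    refine le_of_tendsto' (hFlim.add ((hlim.sub_const a).norm.pow 2)) fun j => ?_
    have h1 := hval (φ j)
    have h2 : 0 ≤ (φ j : ℝ) * Metric.infDist (G (x (φ j))) K ^ 2 := by positivity
    simp only [Function.comp_apply]
    linarith
  -- The proximal term ‖z - a‖² makes a the strict minimizer on the ball.
  have hxa : xbar = a := by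
    have h1 := hmin xbar hxbar hGbar
    have h2 : ‖xbar - a‖ ^ 2 = 0 := le_antisymm (by linarith) (sq_nonneg _)
    simpa [sub_eq_zero] using h2
  exact ⟨x ∘ φ, fun j => φ j, fun j => Nat.cast_nonneg _, hxa ▸ hlim, fun j => hxmin (φ j)⟩

/-- **Fritz John conditions** for minimizing `F` subject to `G x ∈ K`. -/
theorem fritz_john {F : E → ℝ} {G : E → Y} {K : Set Y} (hclosed : IsClosed K)
    (hconv : Convex ℝ K) {a : E} (hF : ContDiffAt ℝ 1 F a) (hG : ContDiffAt ℝ 1 G a)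
    (ha : G a ∈ K) (hmin : IsLocalMinOn F {z | G z ∈ K} a) :
    ∃ (μ : ℝ) (y : Y), (μ ≠ 0 ∨ y ≠ 0) ∧ 0 ≤ μ ∧ (∀ z ∈ K, ⟪y, z - G a⟫ ≤ 0) ∧
      ∀ h, μ * fderiv ℝ F a h + ⟪y, fderiv ℝ G a h⟫ = 0 := by
  have hne : K.Nonempty := ⟨_, ha⟩
  obtain ⟨r, hr, hball⟩ := Metric.nhds_basis_closedBall.eventually_iff.1
    (((hF.eventually (by simp)).and (hG.eventually (by simp))).and
      (eventually_nhdsWithin_iff.1 hmin))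
  have hFd : ∀ z ∈ Metric.closedBall a r, DifferentiableAt ℝ F z := fun z hz =>
    (hball hz).1.1.differentiableAt (by simp)
  have hGd : ∀ z ∈ Metric.closedBall a r, DifferentiableAt ℝ G z := fun z hz =>
    (hball hz).1.2.differentiableAt (by simp)
  obtain ⟨x₀, k₀, hk₀, hx₀, hmin₀⟩ := exists_penalty_minimizers hclosed hr
    (fun z hz => (hFd z hz).continuousAt.continuousWithinAt)
    (fun z hz => (hGd z hz).continuousAt.continuousWithinAt) ha (fun z hz => (hball hz).2)
  -- Dropping finitely many terms puts the minimizers inside the open ball, where they are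
  -- unconstrained local minimizers.
  obtain ⟨N, hN⟩ := eventually_atTop.1 (hx₀ (Metric.ball_mem_nhds a hr))
  let x : ℕ → E := fun j => x₀ (j + N)
  let k : ℕ → ℝ := fun j => k₀ (j + N)
  have hx : Tendsto x atTop (𝓝 a) := hx₀.comp (tendsto_add_atTop_nat N)
  have hxball : ∀ j, x j ∈ Metric.ball a r := fun j => hN _ (Nat.le_add_left N j)
  choose p hpK hpd hpn using fun j => exists_projection hne hclosed hconv (G (x j))
  let v : ℕ → Y := fun j => (2 * k j) • (G (x j) - p j)
  have hstat : ∀ j h, fderiv ℝ F (x j) h + 2 * ⟪x j - a, h⟫ + ⟪v j, fderiv ℝ G (x j) h⟫ = 0 :=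
    fun j h => stationarity_of_isLocalMin_penalty (hk₀ (j + N))
      (hFd _ (Metric.ball_subset_closedBall (hxball j)))
      (hGd _ (Metric.ball_subset_closedBall (hxball j)))
      ((hmin₀ (j + N)).isLocalMin (mem_of_superset (Metric.isOpen_ball.mem_nhds (hxball j))
        Metric.ball_subset_closedBall)) (hpK j) (hpd j) h
  have hGx : Tendsto (fun j => G (x j)) atTop (𝓝 (G a)) := hG.continuousAt.tendsto.comp hx
  have hp : Tendsto p atTop (𝓝 (G a)) := by
    have h1 : Tendsto (fun j => Metric.infDist (G (x j)) K) atTop (𝓝 0) := by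
      have := ((Metric.continuous_infDist_pt K).tendsto (G a)).comp hGx
      rwa [Metric.infDist_zero_of_mem ha] at this
    have h2 : Tendsto (fun j => G (x j) - p j) atTop (𝓝 0) := by
      rw [tendsto_zero_iff_norm_tendsto_zero]
      simpa [hpd] using h1
    simpa using hGx.sub h2
  -- The v j may be unbounded, so (1, v j) is normalized before passing to a convergent subsequence.
  let s : ℕ → ℝ := fun j => 1 + ‖v j‖
  have hs : ∀ j, 0 < s j := fun j => by positivity
  let q : ℕ → ℝ × Y := fun j => ((s j)⁻¹, (s j)⁻¹ • v j)
  have hqnorm : ∀ j, (q j).1 + ‖(q j).2‖ = 1 := fun j => by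
    simp only [q, norm_smul, norm_inv, Real.norm_of_nonneg (hs j).le]
    have := (hs j).ne'
    field_simp
    rfl
  have hq1 : ∀ j, 0 ≤ (q j).1 := fun j => (inv_pos.2 (hs j)).le
  have hqmem : ∀ j, q j ∈ Metric.closedBall (0 : ℝ × Y) 1 := fun j => by
    rw [mem_closedBall_zero_iff, Prod.norm_def, Real.norm_of_nonneg (hq1 j)]
    exact max_le (by linarith [hqnorm j, norm_nonneg (q j).2]) (by linarith [hqnorm j, hq1 j])
  obtain ⟨⟨μ, y⟩, -, φ, hφ, hq⟩ := (isCompact_closedBall (0 : ℝ × Y) 1).tendsto_subseq hqmem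
  have hμ : Tendsto (fun j => (q (φ j)).1) atTop (𝓝 μ) := (continuous_fst.tendsto _).comp hq
  have hy : Tendsto (fun j => (q (φ j)).2) atTop (𝓝 y) := (continuous_snd.tendsto _).comp hq
  have hxφ : Tendsto (fun j => x (φ j)) atTop (𝓝 a) := hx.comp hφ.tendsto_atTop
  refine ⟨μ, y, ?_, ge_of_tendsto' hμ fun j => hq1 _, fun z hz => ?_, fun h => ?_⟩
  -- The normalization `hqnorm` survives the limit, so μ + ‖y‖ = 1.
  · by_contra! hzero
    have h1 := tendsto_nhds_unique (hμ.add hy.norm)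
      (tendsto_const_nhds.congr fun j => (hqnorm (φ j)).symm)
    simp [hzero.1, hzero.2] at h1
  · refine le_of_tendsto' (hy.inner ((tendsto_const_nhds (x := z)).sub
      (hp.comp hφ.tendsto_atTop))) fun j => ?_
    simp only [q, v, Function.comp_apply, real_inner_smul_left]
    have h1 : 0 ≤ (s (φ j))⁻¹ := hq1 _
    have h2 : 0 ≤ k (φ j) := hk₀ _
    exact mul_nonpos_of_nonneg_of_nonpos h1
      (mul_nonpos_of_nonneg_of_nonpos (by linarith) (hpn _ z hz))
  · have hdF : Tendsto (fun j => fderiv ℝ F (x (φ j)) h) atTop (𝓝 (fderiv ℝ F a h)) :=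
      (((hF.fderiv_right (m := 0) (by simp)).continuousAt.clm_apply
        continuousAt_const).tendsto).comp hxφ
    have hdG : Tendsto (fun j => fderiv ℝ G (x (φ j)) h) atTop (𝓝 (fderiv ℝ G a h)) :=
      (((hG.fderiv_right (m := 0) (by simp)).continuousAt.clm_apply
        continuousAt_const).tendsto).comp hxφ
    have hin : Tendsto (fun j => 2 * ⟪x (φ j) - a, h⟫) atTop (𝓝 0) := by
      simpa using ((hxφ.sub_const a).inner (tendsto_const_nhds (x := h)) (𝕜 := ℝ)).const_mul (2 : ℝ)
    have hlim := (hμ.mul (hdF.add hin)).add (hy.inner hdG)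
    rw [add_zero] at hlim
    refine tendsto_nhds_unique hlim (tendsto_const_nhds.congr fun j => ?_)
    simp only [q, real_inner_smul_left]
    linear_combination -(s (φ j))⁻¹ * hstat (φ j) h

/-- Under Robinson's constraint qualification a local minimizer has a Lagrange multiplier. -/
theorem exists_multiplier_of_robinson {F : E → ℝ} {G : E → Y} {K : Set Y} (hclosed : IsClosed K)
    (hconv : Convex ℝ K) {a : E} (hF : ContDiffAt ℝ 1 F a) (hG : ContDiffAt ℝ 1 G a)
    (ha : G a ∈ K) (hmin : IsLocalMinOn F {z | G z ∈ K} a)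
    (hR : range (fderiv ℝ G a) + bouligandTangentCone K (G a) = univ) :
    ∃ y : Y, (∀ h, fderiv ℝ F a h + ⟪y, fderiv ℝ G a h⟫ = 0) ∧
      y ∈ polarNormalCone K (G a) := by
  obtain ⟨μ, y, hne, hμ, hyK, hstat⟩ := fritz_john hclosed hconv hF hG ha hmin
  have hμ0 : μ ≠ 0 := by
    rintro rfl
    refine hne.elim (fun h => h rfl) fun h => h ?_
    exact eq_zero_of_singular_multiplier (fderiv ℝ G a : E →ₗ[ℝ] Y) hR
      (fun h => by simpa using hstat h) ((mem_polarNormalCone_iff hconv ha).2 hyK)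
  refine ⟨μ⁻¹ • y, fun h => ?_, (mem_polarNormalCone_iff hconv ha).2 fun z hz => ?_⟩
  · rw [real_inner_smul_left]
    field_simp
    linear_combination hstat h
  · rw [real_inner_smul_left]
    exact mul_nonpos_of_nonneg_of_nonpos (inv_nonneg.2 hμ) (hyK z hz)

end FritzJohn

/-! ### Transfer between the manifold and a chart -/

section Chart

variable {n : ℕ} {M : Type*} [TopologicalSpace M] [ChartedSpace (EuclideanSpace ℝ (Fin n)) M]
  {F : Type*} [NormedAddCommGroup F] [NormedSpace ℝ F]

/-- The differential of a vector-valued function, read in the preferred chart. -/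
theorem mvfderiv_eq_fderiv_comp_extChartAt_symm {h : M → F} {x : M}
    (hh : MDifferentiableAt (𝓡 n) 𝓘(ℝ, F) h x) (ξ : EuclideanSpace ℝ (Fin n)) :
    mvfderiv (𝓡 n) h x ξ =
      fderiv ℝ (h ∘ (extChartAt (𝓡 n) x).symm) (extChartAt (𝓡 n) x x) ξ := by
  rw [← fderivWithin_univ, ← ModelWithCorners.range_eq_univ (𝓡 n)]
  simp only [mvfderiv, hh.mfderiv]
  rfl

theorem ContMDiff.contDiffAt_comp_extChartAt_symm {h : M → F}
    (hh : ContMDiff (𝓡 n) 𝓘(ℝ, F) 2 h) (x : M) :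
    ContDiffAt ℝ 1 (h ∘ (extChartAt (𝓡 n) x).symm) (extChartAt (𝓡 n) x x) := by
  have h1 := ((contMDiffAt_iff.1 (hh x)).2).of_le (m := 1) (by norm_num)
  rw [ModelWithCorners.range_eq_univ, contDiffWithinAt_univ] at h1
  exact h1

variable {Y : Type*} [NormedAddCommGroup Y] [InnerProductSpace ℝ Y]

/-- Local optimality is inherited by the problem read in the preferred chart. -/
theorem IsLocallyOptimal.isLocalMinOn_comp_extChartAt_symm {Z : Type*} {f : M → ℝ} {g : M → Z}
    {K : Set Z} {x : M} (h : IsLocallyOptimal f g K x) :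
    IsLocalMinOn (f ∘ (extChartAt (𝓡 n) x).symm)
      {z | (g ∘ (extChartAt (𝓡 n) x).symm) z ∈ K} (extChartAt (𝓡 n) x x) := by
  have hc : Tendsto (extChartAt (𝓡 n) x).symm (𝓝 (extChartAt (𝓡 n) x x)) (𝓝 x) := by
    simpa using (continuousAt_extChartAt_symm (I := 𝓡 n) x).tendsto
  refine eventually_nhdsWithin_iff.2 ?_
  filter_upwards [hc.eventually (eventually_nhdsWithin_iff.1 h.2)] with z hz hzK
  simpa using hz hzK

theorem mvfderiv_lagrangian {f : M → ℝ} {g : M → Y} {x : M}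
    (hf : MDifferentiableAt (𝓡 n) 𝓘(ℝ, ℝ) f x) (hg : MDifferentiableAt (𝓡 n) 𝓘(ℝ, Y) g x)
    (y : Y) (ξ : TangentSpace (𝓡 n) x) :
    mvfderiv (𝓡 n) (lagrangian f g y) x ξ =
      mvfderiv (𝓡 n) f x ξ + ⟪y, mvfderiv (𝓡 n) g x ξ⟫ := by
  have hL := hf.hasMFDerivAt.add
    (((innerSL ℝ y).hasFDerivAt (x := g x)).hasMFDerivAt.comp x hg.hasMFDerivAt)
  have hL' := hL.mfderiv
  change mfderiv (𝓡 n) 𝓘(ℝ, ℝ) (lagrangian f g y) x = _ at hL'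
  simp only [mvfderiv, hL']
  rfl

/-- The Lagrange multiplier set in terms of differentials. -/
theorem multiplierSet_eq [RiemannianBundle (fun x : M => TangentSpace (𝓡 n) x)]
    {f : M → ℝ} {g : M → Y} {x : M} (hf : MDifferentiableAt (𝓡 n) 𝓘(ℝ, ℝ) f x)
    (hg : MDifferentiableAt (𝓡 n) 𝓘(ℝ, Y) g x) (K : Set Y) :
    multiplierSet (n := n) f g K x =
      {y | (∀ ξ : TangentSpace (𝓡 n) x,
        (mvfderiv (𝓡 n) f x).toLinearMap ξ + ⟪y, (mvfderiv (𝓡 n) g x).toLinearMap ξ⟫ = 0) ∧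
        y ∈ polarNormalCone K (g x)} := by
  ext y
  refine and_congr_left fun _ => ⟨fun h ξ => ?_, fun h => ?_⟩
  · have h1 := inner_riemannianGrad (lagrangian f g y) x ξ
    rw [h, inner_zero_left, mvfderiv_lagrangian hf hg] at h1
    exact h1.symm
  -- The differential is tested on the gradient itself.
  · refine inner_self_eq_zero (𝕜 := ℝ).1 ?_
    rw [inner_riemannianGrad, mvfderiv_lagrangian hf hg]
    exact h _

end Chart

theorem mainTheorem6 {n : ℕ} {M : Type*} [TopologicalSpace M]
    [ChartedSpace (EuclideanSpace ℝ (Fin n)) M] [IsManifold (𝓡 n) ∞ M]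
    [RiemannianBundle (fun x : M => TangentSpace (𝓡 n) x)]
    [IsContMDiffRiemannianBundle (𝓡 n) ∞ (EuclideanSpace ℝ (Fin n))
      (fun x : M => TangentSpace (𝓡 n) x)]
    {Y : Type*} [NormedAddCommGroup Y] [InnerProductSpace ℝ Y] [FiniteDimensional ℝ Y]
    (f : M → ℝ) (g : M → Y)
    (hf : ContMDiff (𝓡 n) 𝓘(ℝ, ℝ) 2 f) (hg : ContMDiff (𝓡 n) 𝓘(ℝ, Y) 2 g)
    (K : Set Y) (hK_nonempty : K.Nonempty) (hK_closed : IsClosed K) (hK_convex : Convex ℝ K)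
    (xstar : M) (hxstar : IsLocallyOptimal f g K xstar) :
    ((multiplierSet (n := n) f g K xstar).Nonempty ∧
      Convex ℝ (multiplierSet (n := n) f g K xstar) ∧
      Bornology.IsBounded (multiplierSet (n := n) f g K xstar) ∧
      IsCompact (multiplierSet (n := n) f g K xstar)) ↔
    MRCQ (n := n) g K xstar := by
  have hfd : MDifferentiableAt (𝓡 n) 𝓘(ℝ, ℝ) f xstar := (hf xstar).mdifferentiableAt (by simp)
  have hgd : MDifferentiableAt (𝓡 n) 𝓘(ℝ, Y) g xstar := (hg xstar).mdifferentiableAt (by simp)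
  rw [multiplierSet_eq hfd hgd K]
  constructor
  · rintro ⟨hne, -, hbdd, -⟩
    exact ⟨hxstar.1, robinson_of_isBounded_multipliers hK_convex hxstar.1 _ _ hne hbdd⟩
  · rintro ⟨hfeas, hR⟩
    have hbdd := isBounded_multipliers (mvfderiv (𝓡 n) g xstar).toLinearMap
      (mvfderiv (𝓡 n) f xstar).toLinearMap hR
    refine ⟨?_, convex_multipliers _ _, hbdd,
      Metric.isCompact_of_isClosed_isBounded (isClosed_multipliers _ _) hbdd⟩
    have hrange : range (fderiv ℝ (g ∘ (extChartAt (𝓡 n) xstar).symm)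
        (extChartAt (𝓡 n) xstar xstar)) = range (mvfderiv (𝓡 n) g xstar) :=
      congrArg range (funext fun ξ => (mvfderiv_eq_fderiv_comp_extChartAt_symm hgd ξ).symm)
    have hgx : (g ∘ (extChartAt (𝓡 n) xstar).symm) (extChartAt (𝓡 n) xstar xstar) = g xstar := by
      simp
    obtain ⟨y, hy, hyN⟩ := exists_multiplier_of_robinson hK_closed hK_convex
      (hf.contDiffAt_comp_extChartAt_symm xstar) (hg.contDiffAt_comp_extChartAt_symm xstar)
      (by rw [hgx]; exact hfeas) hxstar.isLocalMinOn_comp_extChartAt_symm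
      (by rw [hrange, hgx]; exact hR)
    rw [hgx] at hyN
    refine ⟨y, fun ξ => ?_, hyN⟩
    have hfξ := mvfderiv_eq_fderiv_comp_extChartAt_symm hfd ξ
    have hgξ := mvfderiv_eq_fderiv_comp_extChartAt_symm hgd ξ
    exact (congrArg₂ (fun (s : ℝ) (w : Y) => s + ⟪y, w⟫) hfξ hgξ).trans (hy ξ)
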